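/- **Theorem (a Schnol type theorem).** Let $\Gamma$ be a connected infinite metric graph with a countable vertex set (loops and multiple edges allowed), in which every vertex has finite positive degree and every edge $e$ is identified with a segment $[0,l_e]$, where $l_e\in[l_0,L]$ for some constants $0<l_0\le L<\infty$ independent of $e$ (Condition A). Let $o$ be a root vertex, let $\rho(x)$ be the shortest path distance from $o$ to the point $x\in\Gamma$, and let $B_r=\{x\in\Gamma : \rho(x)\le r\}$. At each vertex $v$ let homogeneous linear self-adjoint vertex conditions be given, that is, a linear subspace $M_v$ of the space of pairs $(F,F')$ of complex vectors indexed by the edge ends at $v$, such that $M_v$ equals its own orthogonal complement with respect to the form $\sum_h \bigl(F'_h\overline{G_h}-F_h\overline{G'_h}\bigr)$. A function $f$ that is $H^2$ on each edge satisfies the vertex conditions if for each $v$ the pair consisting of its boundary values and of its derivatives in the directions from $v$ into the edges lies in $M_v$. Let $H=-\frac{d^2}{dx^2}$ be the operator in $L^2(\Gamma)$ whose domain consists of all $f\in L^2(\Gamma)$ that belong to $H^2(e)$ for each edge $e$, satisfy the vertex conditions and have $f''\in L^2(\Gamma)$. Let $\lambda\in\mathbb{R}$. Suppose there is a function $\varphi:\Gamma\to\mathbb{C}$,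 not identically zero, that belongs to the Sobolev space $H^2(e)$ on each edge $e$, satisfies all vertex conditions and the equation $-\frac{d^2\varphi}{dx^2}=\lambda\varphi$ for a.e. $x\in\Gamma$, and such that for every $\epsilon>0$ there is a constant $C_\epsilon$ with $$\int_{B_r}|\varphi(x)|^2\,dx\le C_\epsilon e^{\epsilon r}\qquad\text{for all } r\ge 0 .$$ Then $\lambda\in\sigma(H)$. -/

import Mathlib

open MeasureTheory Set
open scoped ENNReal ContDiff ComplexConjugate

noncomputable section

/-- A metric graph with vertex set `V` and edge set `E`; loops and multiple edges are allowed.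
Each edge `e` is identified with the segment `[0, len e]`, the point `0` being attached to the
vertex `init e` and the point `len e` to the vertex `term e`. The choice of direction only serves
to fix the coordinate. Every vertex has finite positive degree. -/
structure MetricGraph (V E : Type*) where
  init : E → V
  term : E → V
  len : E → ℝ
  len_pos : ∀ e, 0 < len e
  finite_edges : ∀ v, {e | init e = v ∨ term e = v}.Finite
  nonempty_edges : ∀ v, {e | init e = v ∨ term e = v}.Nonempty

namespace MetricGraph

variable {V E : Type*} (Γ : MetricGraph V E)

/-- The vertex at an end of an edge: `(e, false)` is the end `x = 0` of `e`, and `(e, true)` is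
the end `x = len e`. -/
def vert (h : E × Bool) : V := if h.2 then Γ.term h.1 else Γ.init h.1

/-- The edge ends attached to the vertex `v` (a loop at `v` has both its ends there). -/
abbrev Ends (v : V) : Type _ := {h : E × Bool // Γ.vert h = v}

instance finite_ends (v : V) : Finite (Γ.Ends v) := by
  have h : {h : E × Bool | Γ.vert h = v}.Finite := by
    refine ((Γ.finite_edges v).prod (Set.finite_univ (α := Bool))).subset ?_
    rintro ⟨e, b⟩ hb
    refine ⟨?_, trivial⟩
    cases b
    · exact Or.inl (by simpa [vert] using hb)
    · exact Or.inr (by simpa [vert] using hb)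
  exact h.to_subtype

instance fintype_ends (v : V) : Fintype (Γ.Ends v) := Fintype.ofFinite _

/-- `Γ.HasPath u v a`: there is an edge path of total length `a` from the vertex `u` to the
vertex `v`. -/
inductive HasPath (u : V) : V → ℝ → Prop
  | nil : HasPath u u 0
  | cons (e : E) (b : Bool) (a : ℝ) :
      HasPath u (Γ.vert (e, b)) a → HasPath u (Γ.vert (e, !b)) (a + Γ.len e)

def Connected : Prop := ∀ u v, ∃ a, Γ.HasPath u v a

/-- The natural (shortest path) distance between two vertices. -/
def vertexDist (u v : V) : ℝ := sInf {a | Γ.HasPath u v a}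

/-- The distance `ρ(o, x)` between the vertex `o` and the point of the edge `e` with
coordinate `x ∈ [0, len e]`: a shortest path enters `e` through one of its two ends. -/
def pointDist (o : V) (e : E) (x : ℝ) : ℝ :=
  min (Γ.vertexDist o (Γ.init e) + x) (Γ.vertexDist o (Γ.term e) + (Γ.len e - x))

/-- The part in the edge `e` of the ball `B_r = {x ∈ Γ | ρ(o, x) ≤ r}`. -/
def ballOn (o : V) (r : ℝ) (e : E) : Set ℝ :=
  {x | x ∈ Icc 0 (Γ.len e) ∧ Γ.pointDist o e x ≤ r}

/-- The integral `∫_{B_r} |φ(x)|² dx`, with values in `[0, ∞]`. -/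
def ballMass (o : V) (r : ℝ) (φ : E → ℝ → ℂ) : ℝ≥0∞ :=
  ∑' e, ∫⁻ x in Γ.ballOn o r e, ‖φ e x‖ₑ ^ 2

/-- All edge lengths lie in an interval `[l₀, L]` with `0 < l₀` and `L < ∞`. -/
def ConditionA : Prop := ∃ l₀ L : ℝ, 0 < l₀ ∧ ∀ e, Γ.len e ∈ Icc l₀ L

/-- Lebesgue measure on the edge `e`. -/
abbrev edgeMeasure (e : E) : Measure ℝ := volume.restrict (Icc 0 (Γ.len e))

/-- The Hilbert space `L²(Γ)`, the Hilbert sum of the spaces `L²(e)`. -/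
abbrev L2 : Type _ := lp (fun e : E => Lp ℂ 2 (Γ.edgeMeasure e)) 2

/-- `g` is the weak derivative of `f` on the open interval `(0, l)`. -/
def IsWeakDeriv (l : ℝ) (f g : ℝ → ℂ) : Prop :=
  ∀ ψ : ℝ → ℝ, ContDiff ℝ ∞ ψ → HasCompactSupport ψ → tsupport ψ ⊆ Ioo 0 l →
    ∫ x in Icc 0 l, deriv ψ x • f x = - ∫ x in Icc 0 l, ψ x • g x

/-- `f` belongs to the Sobolev space `H²(0, l)`, with weak derivatives `f'` and `f''`. As usual
for `H²` on an interval, `f` and `f'` are the continuous representatives on `[0, l]`, so that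
their values at the end points are meaningful. -/
structure IsH2 (l : ℝ) (f f' f'' : ℝ → ℂ) : Prop where
  cont : ContinuousOn f (Icc 0 l)
  cont' : ContinuousOn f' (Icc 0 l)
  memLp : MemLp f'' 2 (volume.restrict (Icc 0 l))
  weak : IsWeakDeriv l f f'
  weak' : IsWeakDeriv l f' f''

/-- The boundary value of a function at an edge end. -/
def endValue (φ : E → ℝ → ℂ) (h : E × Bool) : ℂ :=
  if h.2 then φ h.1 (Γ.len h.1) else φ h.1 0

/-- The boundary value at an edge end of the derivative, taken in the direction from the vertex
into the edge; here `φ'` is the derivative with respect to the coordinate of the edge. -/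
def endDeriv (φ' : E → ℝ → ℂ) (h : E × Bool) : ℂ :=
  if h.2 then - φ' h.1 (Γ.len h.1) else φ' h.1 0

/-- Homogeneous linear vertex conditions: for each vertex `v`, a linear subspace of admissible
vectors `(F, F')` of boundary values and outward derivatives at the edge ends attached to `v`. -/
abbrev VertexConditions : Type _ :=
  ∀ v, Submodule ℂ ((Γ.Ends v → ℂ) × (Γ.Ends v → ℂ))

/-- The boundary form at `v` obtained when `-d²/dx²` is integrated by parts. -/
def boundaryForm (v : V) (p q : (Γ.Ends v → ℂ) × (Γ.Ends v → ℂ)) : ℂ :=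
  ∑ h, (p.2 h * conj (q.1 h) - p.1 h * conj (q.2 h))

variable {Γ}

/-- Self-adjoint vertex conditions: at each vertex the admissible subspace is Lagrangian, that is,
equal to its own orthogonal complement with respect to the boundary form. -/
def VertexConditions.SelfAdjoint (M : Γ.VertexConditions) : Prop :=
  ∀ v p, p ∈ M v ↔ ∀ q ∈ M v, Γ.boundaryForm v p q = 0

/-- A function with edge derivatives `φ'` satisfies all vertex conditions. -/
def VertexConditions.Satisfies (M : Γ.VertexConditions) (φ φ' : E → ℝ → ℂ) : Prop :=
  ∀ v, ((fun h : Γ.Ends v => Γ.endValue φ h.1), (fun h : Γ.Ends v => Γ.endDeriv φ' h.1)) ∈ M v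

theorem IsWeakDeriv.add {l : ℝ} {f g f₁ g₁ : ℝ → ℂ}
    (hf : IntegrableOn f (Icc 0 l)) (hg : IntegrableOn g (Icc 0 l))
    (hf₁ : IntegrableOn f₁ (Icc 0 l)) (hg₁ : IntegrableOn g₁ (Icc 0 l))
    (h : IsWeakDeriv l f g) (h₁ : IsWeakDeriv l f₁ g₁) :
    IsWeakDeriv l (f + f₁) (g + g₁) := by
  intro ψ hψ hc hs
  have hb : ∀ (χ : ℝ → ℝ) (u : ℝ → ℂ), Continuous χ → IntegrableOn u (Icc 0 l) →
      IntegrableOn (fun x => χ x • u x) (Icc 0 l) := fun χ u hχ hu =>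
    hu.continuousOn_smul hχ.continuousOn isCompact_Icc
  have hψ' : Continuous (deriv ψ) := hψ.continuous_deriv (by simp)
  simp only [Pi.add_apply, smul_add]
  rw [integral_add (hb _ _ hψ' hf) (hb _ _ hψ' hf₁),
    integral_add (hb _ _ hψ.continuous hg) (hb _ _ hψ.continuous hg₁),
    h ψ hψ hc hs, h₁ ψ hψ hc hs, neg_add]

theorem IsWeakDeriv.smul {l : ℝ} {f g : ℝ → ℂ} (c : ℂ) (h : IsWeakDeriv l f g) :
    IsWeakDeriv l (c • f) (c • g) := by
  intro ψ hψ hc hs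
  have hcomm : ∀ (χ : ℝ → ℝ) (u : ℝ → ℂ),
      ∫ x in Icc 0 l, χ x • (c • u) x = c • ∫ x in Icc 0 l, χ x • u x := by
    intro χ u
    rw [← integral_smul]
    refine integral_congr_ae (Filter.Eventually.of_forall fun x => ?_)
    simp only [Pi.smul_apply]
    rw [smul_comm]
  rw [hcomm, hcomm, h ψ hψ hc hs, smul_neg]

theorem IsH2.integrable {l : ℝ} {f f' f'' : ℝ → ℂ} (h : IsH2 l f f' f'') :
    IntegrableOn f (Icc 0 l) ∧ IntegrableOn f' (Icc 0 l) ∧ IntegrableOn f'' (Icc 0 l) :=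
  ⟨h.cont.integrableOn_compact isCompact_Icc, h.cont'.integrableOn_compact isCompact_Icc,
    h.memLp.integrable (by norm_num)⟩

theorem IsH2.add {l : ℝ} {f f' f'' g g' g'' : ℝ → ℂ} (h : IsH2 l f f' f'')
    (k : IsH2 l g g' g'') : IsH2 l (f + g) (f' + g') (f'' + g'') where
  cont := h.cont.add k.cont
  cont' := h.cont'.add k.cont'
  memLp := h.memLp.add k.memLp
  weak := h.weak.add h.integrable.1 h.integrable.2.1 k.integrable.1 k.integrable.2.1 k.weak
  weak' := h.weak'.add h.integrable.2.1 h.integrable.2.2 k.integrable.2.1 k.integrable.2.2 k.weak'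

theorem IsH2.smul {l : ℝ} {f f' f'' : ℝ → ℂ} (c : ℂ) (h : IsH2 l f f' f'') :
    IsH2 l (c • f) (c • f') (c • f'') where
  cont := h.cont.const_smul c
  cont' := h.cont'.const_smul c
  memLp := h.memLp.const_smul c
  weak := h.weak.smul c
  weak' := h.weak'.smul c

theorem IsH2.zero (l : ℝ) : IsH2 l 0 0 0 where
  cont := continuousOn_const
  cont' := continuousOn_const
  memLp := MemLp.zero
  weak := by intro ψ _ _ _; simp
  weak' := by intro ψ _ _ _; simp

theorem IsWeakDeriv.ae_zero {l : ℝ} {f g : ℝ → ℂ} (hg : IntegrableOn g (Icc 0 l))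
    (h : IsWeakDeriv l f g) (hf : f =ᵐ[volume.restrict (Icc 0 l)] 0) :
    g =ᵐ[volume.restrict (Icc 0 l)] 0 := by
  have key : ∀ᵐ x ∂volume, x ∈ Ioo 0 l → g x = 0 := by
    refine isOpen_Ioo.ae_eq_zero_of_integral_contDiff_smul_eq_zero
      (hg.mono_set Ioo_subset_Icc_self).locallyIntegrableOn ?_
    intro ψ hψ hc hs
    have h0 : ∫ x in Icc 0 l, deriv ψ x • f x = 0 := by
      refine integral_eq_zero_of_ae ?_
      filter_upwards [hf] with x hx
      simp [hx]
    have h1 := h ψ hψ hc hs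
    rw [h0, eq_comm, neg_eq_zero] at h1
    rw [← h1, setIntegral_eq_integral_of_forall_compl_eq_zero]
    intro x hx
    have : ψ x = 0 := image_eq_zero_of_notMem_tsupport
      fun hx' => hx (Ioo_subset_Icc_self (hs hx'))
    simp [this]
  rw [← restrict_Ioo_eq_restrict_Icc]
  exact (ae_restrict_iff' measurableSet_Ioo).2 key

variable (Γ)

/-- The graph of the Hamiltonian: the pairs `(φ, -φ'')` with `φ` in `H²(e)` on each edge `e`,
subject to the vertex conditions, and with `φ` and `φ''` in `L²(Γ)`. -/
def hamiltonianGraph (M : Γ.VertexConditions) : Submodule ℂ (Γ.L2 × Γ.L2) where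
  carrier := {p | ∃ φ φ' φ'' : E → ℝ → ℂ,
    (∀ e, IsH2 (Γ.len e) (φ e) (φ' e) (φ'' e)) ∧ M.Satisfies φ φ' ∧
    (∀ e, p.1 e =ᵐ[Γ.edgeMeasure e] φ e) ∧ (∀ e, p.2 e =ᵐ[Γ.edgeMeasure e] - φ'' e)}
  zero_mem' := by
    refine ⟨0, 0, 0, fun e => IsH2.zero _, fun v => ?_, fun e => ?_, fun e => ?_⟩
    · convert (M v).zero_mem using 1
      ext h <;> simp [endValue, endDeriv]
    · simpa using Lp.coeFn_zero ℂ 2 (Γ.edgeMeasure e)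
    · simpa using Lp.coeFn_zero ℂ 2 (Γ.edgeMeasure e)
  add_mem' := by
    rintro p q ⟨φ, φ', φ'', h, hM, h1, h2⟩ ⟨χ, χ', χ'', k, kM, k1, k2⟩
    refine ⟨φ + χ, φ' + χ', φ'' + χ'', fun e => (h e).add (k e), fun v => ?_, fun e => ?_,
      fun e => ?_⟩
    · convert (M v).add_mem (hM v) (kM v) using 1
      ext i
      · simp only [endValue, Pi.add_apply, Prod.mk_add_mk]
        split_ifs <;> rfl
      · simp only [endDeriv, Pi.add_apply, Prod.mk_add_mk]
        split_ifs <;> ring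
    · filter_upwards [h1 e, k1 e, Lp.coeFn_add (p.1 e) (q.1 e)] with x a b c
      simp only [Prod.fst_add, lp.coeFn_add, Pi.add_apply] at c ⊢
      rw [c, a, b]
    · filter_upwards [h2 e, k2 e, Lp.coeFn_add (p.2 e) (q.2 e)] with x a b c
      simp only [Prod.snd_add, lp.coeFn_add, Pi.add_apply, Pi.neg_apply] at a b c ⊢
      rw [c, a, b, neg_add]
  smul_mem' := by
    rintro c p ⟨φ, φ', φ'', h, hM, h1, h2⟩
    refine ⟨c • φ, c • φ', c • φ'', fun e => (h e).smul c, fun v => ?_, fun e => ?_,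
      fun e => ?_⟩
    · convert (M v).smul_mem c (hM v) using 1
      ext i
      · simp only [endValue, Pi.smul_apply, Prod.smul_mk]
        split_ifs <;> rfl
      · simp only [endDeriv, Pi.smul_apply, Prod.smul_mk]
        split_ifs <;> simp
    · filter_upwards [h1 e, Lp.coeFn_smul c (p.1 e)] with x a b
      simp only [Prod.smul_fst, lp.coeFn_smul, Pi.smul_apply] at b ⊢
      rw [b, a]
    · filter_upwards [h2 e, Lp.coeFn_smul c (p.2 e)] with x a b
      simp only [Prod.smul_snd, lp.coeFn_smul, Pi.smul_apply, Pi.neg_apply] at a b ⊢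
      rw [b, a, smul_neg]

theorem hamiltonianGraph_functional (M : Γ.VertexConditions) (p : Γ.L2 × Γ.L2)
    (hp : p ∈ Γ.hamiltonianGraph M) (h0 : p.1 = 0) : p.2 = 0 := by
  obtain ⟨φ, φ', φ'', h, -, h1, h2⟩ := hp
  ext e : 2
  have hφ : φ e =ᵐ[Γ.edgeMeasure e] 0 := by
    refine (h1 e).symm.trans ?_
    rw [h0]
    exact Lp.coeFn_zero ℂ 2 _
  have hφ'' := (h e).weak'.ae_zero (h e).integrable.2.2
    ((h e).weak.ae_zero (h e).integrable.2.1 hφ)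
  refine Lp.ext ((h2 e).trans ?_)
  refine Filter.EventuallyEq.trans ?_ (Lp.coeFn_zero ℂ 2 _).symm
  filter_upwards [hφ''] with x hx
  simp [hx]

/-- The Hamiltonian `H = -d²/dx²` in `L²(Γ)` with the vertex conditions `M`, as an unbounded
operator. -/
def hamiltonian (M : Γ.VertexConditions) : Γ.L2 →ₗ.[ℂ] Γ.L2 :=
  (Γ.hamiltonianGraph M).toLinearPMap

/-- `(u, w)` belongs to the graph of the operator `H` exactly if it belongs to the submodule
from which `H` was built. -/
theorem hamiltonian_graph (M : Γ.VertexConditions) :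
    (Γ.hamiltonian M).graph = Γ.hamiltonianGraph M :=
  Submodule.toLinearPMap_graph_eq _ (Γ.hamiltonianGraph_functional M)

end MetricGraph

/-- The spectrum of an unbounded operator `T`: the complement of the set of all `z` for which
`T - z` maps the domain of `T` bijectively onto the whole space with bounded inverse `R`. -/
def unboundedSpectrum {X : Type*} [NormedAddCommGroup X] [NormedSpace ℂ X]
    (T : X →ₗ.[ℂ] X) : Set ℂ :=
  {z | ∃ R : X →L[ℂ] X, (∀ w, ∃ u : T.domain, (u : X) = R w ∧ T u - z • (u : X) = w) ∧
    ∀ u : T.domain, R (T u - z • (u : X)) = u}ᶜ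

end

namespace MetricGraph

/-! If `lam` were outside the spectrum, a bounded resolvent would give `‖u‖ ≤ c ‖(H - lam) u‖` on
the whole domain. Test this on `u = θφ`, where θ is 1 on edges with both ends within distance `r` of
`o`, 0 on edges with both ends farther away, and a cubic on the remaining edges. Since θ takes one
value at each vertex and θ' vanishes there, the boundary data of φ are only rescaled vertex by
vertex, and `u` stays in the domain.

The error `(H - lam) u = -(θ''φ + 2θ'φ')` lives on the transition edges. A Caccioppoli estimate
(`integral_commutator_sq_le`) removes φ', with a constant uniform in the edge because lengths are at
least `l₀`. Because lengths are at most `L`, the transition edges have both ends within `r + L`.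
With J(r) the mass of φ on edges with both ends within `r`, `exists_quasimode` thus gives J(r) ≤ D
(J(r + L) - J(r)). So J(nL) eventually grows geometrically, against the subexponential bound. -/

/-! ### Weak and classical derivatives on an interval -/

theorem isWeakDeriv_of_hasDerivAt {l : ℝ} (hl : 0 < l) {f g : ℝ → ℂ}
    (hf : ContinuousOn f (Icc 0 l)) (hg : ContinuousOn g (Icc 0 l))
    (h : ∀ x ∈ Ioo 0 l, HasDerivAt f (g x) x) : IsWeakDeriv l f g := by
  intro ψ hψ hc hs
  have hψ' : Continuous (deriv ψ) := hψ.continuous_deriv (by simp)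
  have i1 : IntegrableOn (fun x => deriv ψ x • f x) (Icc 0 l) :=
    (hψ'.continuousOn.smul hf).integrableOn_compact isCompact_Icc
  have i2 : IntegrableOn (fun x => ψ x • g x) (Icc 0 l) :=
    (hψ.continuous.continuousOn.smul hg).integrableOn_compact isCompact_Icc
  have h0 : ψ 0 = 0 := image_eq_zero_of_notMem_tsupport fun hx => (hs hx).1.false
  have h1 : ψ l = 0 := image_eq_zero_of_notMem_tsupport fun hx => (hs hx).2.false
  have key := intervalIntegral.integral_eq_sub_of_hasDerivAt_of_le hl.le
    (f := fun x => ψ x • f x) (f' := fun x => ψ x • g x + deriv ψ x • f x)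
    (hψ.continuous.continuousOn.smul hf)
    (fun x hx => ((hψ.differentiable (by simp)) x).hasDerivAt.smul (h x hx))
    ((intervalIntegrable_iff_integrableOn_Icc_of_le hl.le).2 (i2.add i1))
  rw [intervalIntegral.integral_of_le hl.le, ← integral_Icc_eq_integral_Ioc,
    integral_add i2 i1, h0, h1] at key
  simp only [zero_smul, sub_zero] at key
  exact eq_neg_of_add_eq_zero_right key

/-- The primitive from 0 vanishes to the left of `K` trivially and to the right because the total
integral is zero. So every mean-zero test function is the derivative of a test function. -/
theorem exists_contDiff_antideriv {l : ℝ} {χ : ℝ → ℝ} (hχ : ContDiff ℝ ∞ χ) {K : Set ℝ}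
    (hK : IsCompact K) (hne : K.Nonempty) (hKl : K ⊆ Ioo 0 l) (hsupp : ∀ x ∉ K, χ x = 0)
    (hint : ∫ x, χ x = 0) :
    ∃ Ψ : ℝ → ℝ, ContDiff ℝ ∞ Ψ ∧ HasCompactSupport Ψ ∧ tsupport Ψ ⊆ Ioo 0 l ∧
      deriv Ψ = χ := by
  obtain ⟨a, haK, ha⟩ := hK.exists_isLeast hne
  obtain ⟨b, hbK, hb⟩ := hK.exists_isGreatest hne
  have hzero : ∀ x ∉ Icc a b, χ x = 0 := fun x hx => hsupp x fun hxK => hx ⟨ha hxK, hb hxK⟩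
  set Ψ : ℝ → ℝ := fun x => ∫ t in (0 : ℝ)..x, χ t
  have hd : ∀ x, HasDerivAt Ψ (χ x) x := fun x => by
    exact (hχ.continuous.integral_hasStrictDerivAt 0 x).hasDerivAt
  have hder : deriv Ψ = χ := funext fun x => (hd x).deriv
  have hsub : tsupport Ψ ⊆ Icc a b := by
    refine closure_minimal (fun x hx => ?_) isClosed_Icc
    by_contra hxab
    apply hx
    rcases lt_or_ge x a with hxa | hxa
    · refine (intervalIntegral.integral_congr (g := fun _ => 0) fun t ht => ?_).trans (by simp)
      refine hzero t fun h => ?_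
      rw [mem_uIcc] at ht
      have := (hKl haK).1
      rcases ht with ht | ht <;> linarith [h.1, ht.1, ht.2]
    · have hbx : b < x := by
        by_contra hbx
        exact hxab ⟨hxa, not_lt.1 hbx⟩
      have h0x : (0 : ℝ) ≤ x := ((hKl hbK).1.trans hbx).le
      change ∫ t in (0 : ℝ)..x, χ t = 0
      rw [intervalIntegral.integral_of_le h0x, setIntegral_eq_integral_of_forall_compl_eq_zero,
        hint]
      intro t ht
      exact hzero t fun h => ht ⟨(hKl haK).1.trans_le h.1, h.2.trans hbx.le⟩
  refine ⟨Ψ, ?_, isCompact_Icc.of_isClosed_subset (isClosed_tsupport _) hsub, ?_, hder⟩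
  · rw [contDiff_infty_iff_deriv, hder]
    exact ⟨fun x => (hd x).differentiableAt, hχ⟩
  · exact hsub.trans fun x hx => ⟨(hKl haK).1.trans_le hx.1, hx.2.trans_lt (hKl hbK).2⟩

/-- The lemma of du Bois-Reymond. -/
theorem IsWeakDeriv.eq_const {l : ℝ} (hl : 0 < l) {h : ℝ → ℂ} (hh : ContinuousOn h (Icc 0 l))
    (hw : IsWeakDeriv l h 0) : ∃ c, ∀ x ∈ Ioo 0 l, h x = c := by
  let B : ContDiffBump (l / 2) := ⟨l / 8, l / 4, by linarith, by linarith⟩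
  set ρ : ℝ → ℝ := B.normed volume
  have hρ : ContDiff ℝ ∞ ρ := B.contDiff_normed
  have hball : Metric.closedBall (l / 2) (l / 4) ⊆ Ioo 0 l := by
    rw [Real.closedBall_eq_Icc]
    exact fun x hx => ⟨by linarith [hx.1], by linarith [hx.2]⟩
  have hρs : tsupport ρ = Metric.closedBall (l / 2) (l / 4) := B.tsupport_normed_eq
  have hρc : HasCompactSupport ρ := B.hasCompactSupport_normed
  have hρi : ∫ x, ρ x = 1 := B.integral_normed
  refine ⟨∫ x in Icc 0 l, ρ x • h x, ?_⟩
  set c := ∫ x in Icc 0 l, ρ x • h x with hc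
  have hi : ∀ ψ : ℝ → ℝ, Continuous ψ → IntegrableOn (fun x => ψ x • h x) (Icc 0 l) :=
    fun ψ hψ => (hψ.continuousOn.smul hh).integrableOn_compact isCompact_Icc
  have key : ∀ᵐ x ∂volume, x ∈ Ioo 0 l → h x - c = 0 := by
    refine isOpen_Ioo.ae_eq_zero_of_integral_contDiff_smul_eq_zero
      (((hh.sub continuousOn_const).integrableOn_compact isCompact_Icc).mono_set
        Ioo_subset_Icc_self).locallyIntegrableOn ?_
    intro ψ hψ hψc hψs
    set m := ∫ x, ψ x
    have hψint : Integrable ψ := hψ.continuous.integrable_of_hasCompactSupport hψc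
    have hρint : Integrable ρ := hρ.continuous.integrable_of_hasCompactSupport hρc
    -- Subtracting `m * ρ` makes the mean of ψ zero. Testing with the resulting Ψ gives `∫ (ψ - m ρ)
    -- h = 0`, that is, `∫ ψ (h - c) = 0`.
    obtain ⟨Ψ, hΨ, hΨc, hΨs, hΨd⟩ := exists_contDiff_antideriv (l := l)
      (χ := fun x => ψ x - m * ρ x) (hψ.sub (contDiff_const.mul hρ))
      (K := tsupport ψ ∪ tsupport ρ) (hψc.isCompact.union hρc.isCompact)
      ⟨l / 2, Or.inr (by rw [hρs]; exact Metric.mem_closedBall_self (by linarith))⟩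
      (union_subset hψs (hρs ▸ hball))
      (fun x hx => by
        rw [image_eq_zero_of_notMem_tsupport fun h => hx (Or.inl h),
          image_eq_zero_of_notMem_tsupport fun h => hx (Or.inr h)]
        simp)
      (by rw [integral_sub hψint (hρint.const_mul m), integral_const_mul, hρi, mul_one, sub_self])
    have h1 := hw Ψ hΨ hΨc hΨs
    rw [hΨd] at h1
    have hψeq : ∫ x in Icc 0 l, ψ x = m := by
      refine setIntegral_eq_integral_of_forall_compl_eq_zero fun x hx => ?_
      exact image_eq_zero_of_notMem_tsupport fun hx' => hx (Ioo_subset_Icc_self (hψs hx'))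
    have hρm : IntegrableOn (fun x => m • ρ x • h x) (Icc 0 l) := (hi ρ hρ.continuous).smul m
    have h2 : ∫ x in Icc 0 l, (ψ x - m * ρ x) • h x =
        (∫ x in Icc 0 l, ψ x • h x) - m • c := by
      rw [hc, ← integral_smul, ← integral_sub (hi ψ hψ.continuous)
        hρm]
      refine integral_congr_ae (Filter.Eventually.of_forall fun x => ?_)
      simp [sub_mul, mul_assoc]
    rw [h2] at h1
    rw [← setIntegral_eq_integral_of_forall_compl_eq_zero (s := Icc 0 l)]
    · simp only [smul_sub]
      rw [integral_sub (hi ψ hψ.continuous) (hψint.integrableOn.smul_const c),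
        integral_smul_const, hψeq]
      simpa using h1
    · intro x hx
      have : ψ x = 0 := image_eq_zero_of_notMem_tsupport
        fun hx' => hx (Ioo_subset_Icc_self (hψs hx'))
      simp [this]
  have := Measure.eqOn_open_of_ae_eq (μ := volume) (U := Ioo 0 l) (f := h) (g := fun _ => c)
    ((ae_restrict_iff' measurableSet_Ioo).2 (key.mono fun x hx hx' => sub_eq_zero.1 (hx hx')))
    isOpen_Ioo (hh.mono Ioo_subset_Icc_self) continuousOn_const
  exact this

/-- Subtracting from `f` a primitive of `g` leaves a function with zero weak derivative, which is
constant on the open interval. -/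
theorem IsWeakDeriv.hasDerivAt {l : ℝ} (hl : 0 < l) {f g : ℝ → ℂ}
    (hf : ContinuousOn f (Icc 0 l)) (hg : ContinuousOn g (Icc 0 l)) (hw : IsWeakDeriv l f g)
    {x : ℝ} (hx : x ∈ Ioo 0 l) : HasDerivAt f (g x) x := by
  have hgi : IntegrableOn g (uIcc 0 l) := by
    rw [uIcc_of_le hl.le]; exact hg.integrableOn_compact isCompact_Icc
  set G : ℝ → ℂ := fun x => ∫ t in (0 : ℝ)..x, g t
  have hGc : ContinuousOn G (Icc 0 l) := by
    have := intervalIntegral.continuousOn_primitive_interval hgi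
    rwa [uIcc_of_le hl.le] at this
  have hGd : ∀ y ∈ Ioo 0 l, HasDerivAt G (g y) y := fun y hy => by
    have hn : Icc 0 l ∈ nhds y := Icc_mem_nhds hy.1 hy.2
    refine intervalIntegral.integral_hasDerivAt_right ?_ ?_ (hg.continuousAt hn)
    · refine ContinuousOn.intervalIntegrable (hg.mono ?_)
      rw [uIcc_of_le hy.1.le]
      exact Icc_subset_Icc_right hy.2.le
    · exact hg.stronglyMeasurableAtFilter_nhdsWithin measurableSet_Icc y |>.filter_mono
        (by rw [nhdsWithin_eq_nhds.2 hn])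
  have hi : ∀ {u : ℝ → ℂ}, ContinuousOn u (Icc 0 l) → IntegrableOn u (Icc 0 l) :=
    fun hu => hu.integrableOn_compact isCompact_Icc
  have h0 : IsWeakDeriv l (f + (-1 : ℂ) • G) 0 := by
    have := hw.add (hi hf) (hi hg) (hi (hGc.const_smul (-1 : ℂ))) (hi (hg.const_smul (-1 : ℂ)))
      ((isWeakDeriv_of_hasDerivAt hl hGc hg hGd).smul (-1 : ℂ))
    rwa [show g + (-1 : ℂ) • g = 0 by simp] at this
  obtain ⟨c, hc⟩ := h0.eq_const hl (hf.add (hGc.const_smul (-1 : ℂ)))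
  refine ((hGd x hx).add_const c).congr_of_eventuallyEq ?_
  filter_upwards [Ioo_mem_nhds hx.1 hx.2] with y hy
  rw [← hc y hy]
  simp

/-! ### Multiplying `H²` functions by smooth functions -/

theorem IsWeakDeriv.mul_contDiff {l : ℝ} {f g : ℝ → ℂ} {θ : ℝ → ℝ} (hθ : ContDiff ℝ ∞ θ)
    (hf : IntegrableOn f (Icc 0 l)) (hg : IntegrableOn g (Icc 0 l)) (hw : IsWeakDeriv l f g) :
    IsWeakDeriv l (fun x => θ x • f x) (fun x => deriv θ x • f x + θ x • g x) := by
  intro ψ hψ hc hs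
  have hb : ∀ (χ : ℝ → ℝ) (u : ℝ → ℂ), Continuous χ → IntegrableOn u (Icc 0 l) →
      IntegrableOn (fun x => χ x • u x) (Icc 0 l) := fun χ u hχ hu =>
    hu.continuousOn_smul hχ.continuousOn isCompact_Icc
  have hψ' : Continuous (deriv ψ) := hψ.continuous_deriv (by simp)
  have hθ' : Continuous (deriv θ) := hθ.continuous_deriv (by simp)
  -- Moving θ onto the test function reduces the claim to the ordinary product rule for `ψ * θ`.
  have h1 := hw (ψ * θ) (hψ.mul hθ) hc.mul_right
    ((tsupport_mul_subset_left).trans hs)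
  have hd : ∀ x, deriv (ψ * θ) x = deriv ψ x * θ x + ψ x * deriv θ x := fun x =>
    deriv_mul ((hψ.differentiable (by simp)) x) ((hθ.differentiable (by simp)) x)
  simp only [hd, add_smul, Pi.mul_apply] at h1
  rw [integral_add (hb (fun x => deriv ψ x * θ x) _ (hψ'.mul hθ.continuous) hf)
    (hb (fun x => ψ x * deriv θ x) _ (hψ.continuous.mul hθ') hf)] at h1
  simp only [smul_add, smul_smul]
  rw [integral_add (hb (fun x => ψ x * deriv θ x) _ (hψ.continuous.mul hθ') hf)
    (hb (fun x => ψ x * θ x) _ (hψ.continuous.mul hθ.continuous) hg), neg_add,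
    ← sub_eq_neg_add]
  exact eq_sub_of_add_eq h1

theorem IsH2.mul_contDiff {l : ℝ} {f f' f'' : ℝ → ℂ} (h : IsH2 l f f' f'') {θ θ' θ'' : ℝ → ℝ}
    (hθ : ContDiff ℝ ∞ θ) (hθd : deriv θ = θ') (hθd' : deriv θ' = θ'') :
    IsH2 l (fun x => θ x • f x) (fun x => θ' x • f x + θ x • f' x)
      (fun x => (θ'' x • f x + (2 * θ' x) • f' x) + θ x • f'' x) := by
  have hθ' : ContDiff ℝ ∞ θ' := hθd ▸ (contDiff_infty_iff_deriv.1 hθ).2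
  have hθ'' : ContDiff ℝ ∞ θ'' := hθd' ▸ (contDiff_infty_iff_deriv.1 hθ').2
  have hb : ∀ {χ : ℝ → ℝ} {u : ℝ → ℂ}, ContDiff ℝ ∞ χ → IntegrableOn u (Icc 0 l) →
      IntegrableOn (fun x => χ x • u x) (Icc 0 l) := fun hχ hu =>
    hu.continuousOn_smul hχ.continuous.continuousOn isCompact_Icc
  obtain ⟨i0, i1, i2⟩ := h.integrable
  refine ⟨hθ.continuous.continuousOn.smul h.cont, (hθ'.continuous.continuousOn.smul h.cont).add
    (hθ.continuous.continuousOn.smul h.cont'), ?_, ?_, ?_⟩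
  · refine MemLp.add ?_ ?_
    · obtain ⟨C, hC⟩ := isCompact_Icc.exists_bound_of_continuousOn (s := Icc 0 l)
        ((hθ''.continuous.continuousOn.smul h.cont).add
        ((continuous_const.mul hθ'.continuous).continuousOn.smul h.cont') :
          ContinuousOn (fun x => θ'' x • f x + (2 * θ' x) • f' x) (Icc 0 l))
      refine MemLp.of_bound (((hb hθ'' i0).add
        (hb (contDiff_const.mul hθ') i1)).aestronglyMeasurable) C ?_
      exact (ae_restrict_iff' measurableSet_Icc).2 (Filter.Eventually.of_forall hC)
    · obtain ⟨C, hC⟩ := isCompact_Icc.exists_bound_of_continuousOn (s := Icc 0 l)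
        hθ.continuous.continuousOn
      refine h.memLp.of_le_mul (c := C) (hb hθ i2).aestronglyMeasurable ?_
      refine (ae_restrict_iff' measurableSet_Icc).2 (Filter.Eventually.of_forall fun x hx => ?_)
      rw [norm_smul]
      exact mul_le_mul_of_nonneg_right (hC x hx) (norm_nonneg _)
  · simpa only [hθd] using h.weak.mul_contDiff hθ i0 i1
  · have hA := h.weak.mul_contDiff hθ' i0 i1
    have hB := h.weak'.mul_contDiff hθ i1 i2
    rw [hθd'] at hA
    rw [hθd] at hB
    have := hA.add (hb hθ' i0) ((hb hθ'' i0).add (hb hθ' i1)) (hb hθ i1)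
      ((hb hθ' i1).add (hb hθ i2)) hB
    have e : (fun x => (θ'' x • f x + (2 * θ' x) • f' x) + θ x • f'' x) =
        ((fun x => θ'' x • f x) + fun x => θ' x • f' x) +
          ((fun x => θ' x • f' x) + fun x => θ x • f'' x) := by
      funext x
      simp only [Pi.add_apply]
      module
    rw [e]
    exact this

/-- This lets the second derivative of an eigenfunction be replaced by the continuous function `-lam
• φ`, so that φ' becomes classically differentiable. -/
theorem IsH2.congr_ae {l : ℝ} {f f' f'' g : ℝ → ℂ} (h : IsH2 l f f' f'')
    (hg : f'' =ᵐ[volume.restrict (Icc 0 l)] g) : IsH2 l f f' g where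
  cont := h.cont
  cont' := h.cont'
  memLp := (memLp_congr_ae hg).1 h.memLp
  weak := h.weak
  weak' := fun ψ hψ hc hs => by
    rw [h.weak' ψ hψ hc hs]
    congr 1
    exact integral_congr_ae (hg.mono fun x hx => by simp only [hx])

/-! ### Caccioppoli estimate for the commutator -/

/-- A Caccioppoli inequality for solutions of `-f'' = lam f`. -/
theorem integral_commutator_sq_le {l lam a b : ℝ} (hl : 0 < l) {f f' : ℝ → ℂ} {χ χ' : ℝ → ℝ}
    (hf : ContinuousOn f (Icc 0 l)) (hf' : ContinuousOn f' (Icc 0 l))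
    (hd : ∀ x ∈ Ioo 0 l, HasDerivAt f (f' x) x)
    (hd' : ∀ x ∈ Ioo 0 l, HasDerivAt f' ((-lam) • f x) x)
    (hχ : ∀ x, HasDerivAt χ (χ' x) x) (hχc : Continuous χ')
    (h0 : χ 0 = 0) (h1 : χ l = 0)
    (ha : ∀ x ∈ Icc 0 l, χ x ^ 2 ≤ a) (hb : ∀ x ∈ Icc 0 l, χ' x ^ 2 ≤ b) :
    ∫ x in Icc 0 l, ‖χ' x • f x + (2 * χ x) • f' x‖ ^ 2 ≤
      (10 * b + 8 * |lam| * a) * ∫ x in Icc 0 l, ‖f x‖ ^ 2 := by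
  have hχ0 : Continuous χ := continuous_iff_continuousAt.2 fun x => (hχ x).continuousAt
  -- χ stands for the derivative θ' of the cutoff. As χ vanishes at both ends, `∫ P' = 0`, and
  -- adding a multiple of `P'` to the integrand trades `χ² ‖f'‖²` for terms in `f`.
  set P : ℝ → ℝ := fun x => χ x ^ 2 * inner ℝ (f x) (f' x)
  set P' : ℝ → ℝ := fun x => 2 * χ x * χ' x * inner ℝ (f x) (f' x) +
    χ x ^ 2 * (inner ℝ (f x) ((-lam) • f x) + inner ℝ (f' x) (f' x))
  have hP : ∀ x ∈ Ioo 0 l, HasDerivAt P (P' x) x := fun x hx => by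
    have := ((hχ x).pow 2).mul ((hd x hx).inner ℝ (hd' x hx))
    refine this.congr_deriv ?_
    simp only [P', Pi.pow_apply]
    push_cast
    ring
  have hPc : ContinuousOn P (Icc 0 l) :=
    (hχ0.pow 2).continuousOn.mul (hf.inner hf')
  have hP'c : ContinuousOn P' (Icc 0 l) :=
    (((continuous_const.mul hχ0).mul hχc).continuousOn.mul (hf.inner hf')).add
      ((hχ0.pow 2).continuousOn.mul ((hf.inner (hf.const_smul (-lam))).add (hf'.inner hf')))
  have hPi : IntegrableOn P' (Icc 0 l) := hP'c.integrableOn_compact isCompact_Icc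
  have hzero : ∫ x in Icc 0 l, P' x = 0 := by
    have := intervalIntegral.integral_eq_sub_of_hasDerivAt_of_le hl.le hPc hP
      ((intervalIntegrable_iff_integrableOn_Icc_of_le hl.le).2 hPi)
    rw [intervalIntegral.integral_of_le hl.le, ← integral_Icc_eq_integral_Ioc] at this
    rw [this]
    simp [P, h0, h1]
  have hfi : IntegrableOn (fun x => ‖f x‖ ^ 2) (Icc 0 l) :=
    (hf.norm.pow 2).integrableOn_compact isCompact_Icc
  have hle : ∫ x in Icc 0 l, ‖χ' x • f x + (2 * χ x) • f' x‖ ^ 2 ≤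
      ∫ x in Icc 0 l, (8 * P' x + (10 * b + 8 * |lam| * a) * ‖f x‖ ^ 2) := by
    refine setIntegral_mono_on ?_ ((hPi.const_mul 8).add (hfi.const_mul _)) measurableSet_Icc ?_
    · exact ((((hχc.continuousOn.smul hf).add
        ((continuous_const.mul hχ0).continuousOn.smul hf')).norm).pow 2).integrableOn_compact
          isCompact_Icc
    · intro x hx
      have e1 : ‖χ' x • f x + (2 * χ x) • f' x‖ ^ 2 = χ' x ^ 2 * ‖f x‖ ^ 2 +
          4 * χ x * χ' x * inner ℝ (f x) (f' x) + 4 * χ x ^ 2 * ‖f' x‖ ^ 2 := by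
        rw [norm_add_sq_real, norm_smul, norm_smul, real_inner_smul_left, real_inner_smul_right,
          mul_pow, mul_pow, Real.norm_eq_abs, Real.norm_eq_abs, sq_abs, sq_abs]
        ring
      -- The factor 8 of `P'` leaves `12 χ χ' ⟨f, f'⟩ + 4 χ² ‖f'‖²`; another `9 χ'² ‖f‖²` completes
      -- the square, whence 10 = 1 + 9.
      have e2 : 0 ≤ 9 * χ' x ^ 2 * ‖f x‖ ^ 2 +
          12 * χ x * χ' x * inner ℝ (f x) (f' x) + 4 * χ x ^ 2 * ‖f' x‖ ^ 2 := by
        have := sq_nonneg ‖(3 * χ' x) • f x + (2 * χ x) • f' x‖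
        rw [norm_add_sq_real, norm_smul, norm_smul, real_inner_smul_left, real_inner_smul_right,
          mul_pow, mul_pow, Real.norm_eq_abs, Real.norm_eq_abs, sq_abs, sq_abs] at this
        linarith
      have e3 : P' x = 2 * χ x * χ' x * inner ℝ (f x) (f' x) +
          χ x ^ 2 * (-lam * ‖f x‖ ^ 2 + ‖f' x‖ ^ 2) := by
        simp only [P']
        rw [real_inner_smul_right, real_inner_self_eq_norm_sq, real_inner_self_eq_norm_sq]
      have e4 : χ' x ^ 2 * ‖f x‖ ^ 2 ≤ b * ‖f x‖ ^ 2 :=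
        mul_le_mul_of_nonneg_right (hb x hx) (sq_nonneg _)
      have e5 : lam * (χ x ^ 2 * ‖f x‖ ^ 2) ≤ |lam| * (a * ‖f x‖ ^ 2) := by
        refine (mul_le_mul_of_nonneg_right (le_abs_self lam) (by positivity)).trans ?_
        exact mul_le_mul_of_nonneg_left
          (mul_le_mul_of_nonneg_right (ha x hx) (sq_nonneg _)) (abs_nonneg _)
      rw [e1, e3]
      linarith
  refine hle.trans_eq ?_
  rw [integral_add (hPi.const_mul 8) (hfi.const_mul _), integral_const_mul, integral_const_mul,
    hzero]
  ring

/-! ### The cutoff profile on one edge -/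

/-- The cubic with values `p` at `0` and `q` at `l` and with vanishing derivative at both points. -/
noncomputable def cubicStep (p q l x : ℝ) : ℝ := p + (q - p) * (3 * (x / l) ^ 2 - 2 * (x / l) ^ 3)

noncomputable def cubicStep' (p q l x : ℝ) : ℝ := (q - p) * (6 * (x / l) - 6 * (x / l) ^ 2) / l

noncomputable def cubicStep'' (p q l x : ℝ) : ℝ := (q - p) * (6 - 12 * (x / l)) / l ^ 2

theorem contDiff_cubicStep (p q l : ℝ) : ContDiff ℝ ∞ (cubicStep p q l) := by
  unfold cubicStep; fun_prop

theorem hasDerivAt_cubicStep (p q l x : ℝ) :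
    HasDerivAt (cubicStep p q l) (cubicStep' p q l x) x := by
  have ht : HasDerivAt (fun x => x / l) (1 / l) x := (hasDerivAt_id x).div_const l
  refine ((((ht.pow 2).const_mul 3).sub ((ht.pow 3).const_mul 2)).const_mul
    (q - p)).const_add p |>.congr_deriv ?_
  unfold cubicStep'
  push_cast
  ring

theorem hasDerivAt_cubicStep' (p q l x : ℝ) :
    HasDerivAt (cubicStep' p q l) (cubicStep'' p q l x) x := by
  have ht : HasDerivAt (fun x => x / l) (1 / l) x := (hasDerivAt_id x).div_const l
  refine ((((ht.const_mul 6).sub ((ht.pow 2).const_mul 6)).const_mul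
    (q - p)).div_const l).congr_deriv ?_
  unfold cubicStep''
  push_cast
  ring

theorem cubicStep_zero (p q l : ℝ) : cubicStep p q l 0 = p := by simp [cubicStep]

theorem cubicStep_right (p q : ℝ) {l : ℝ} (hl : 0 < l) : cubicStep p q l l = q := by
  simp only [cubicStep, div_self hl.ne']; ring

theorem cubicStep'_zero (p q l : ℝ) : cubicStep' p q l 0 = 0 := by simp [cubicStep']

theorem cubicStep'_right (p q : ℝ) {l : ℝ} (hl : 0 < l) : cubicStep' p q l l = 0 := by
  simp [cubicStep', div_self hl.ne']

theorem cubicStep_self (p l x : ℝ) : cubicStep p p l x = p := by simp [cubicStep]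

theorem abs_cubicStep_le {p q l x : ℝ} (hp : |p| ≤ 1) (hq : |q| ≤ 1) (hl : 0 < l)
    (hx : x ∈ Icc 0 l) : |cubicStep p q l x| ≤ 1 := by
  have h0 : 0 ≤ x / l := div_nonneg hx.1 hl.le
  have h1 : x / l ≤ 1 := (div_le_one hl).2 hx.2
  rw [abs_le] at *
  unfold cubicStep
  set t := x / l
  have a0 : 0 ≤ 3 * t ^ 2 - 2 * t ^ 3 := by nlinarith [mul_nonneg (sq_nonneg t) (sub_nonneg.2 h1)]
  -- `1 - 3t² + 2t³ = (1 - t)² (1 + 2t)`.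
  have a1 : 3 * t ^ 2 - 2 * t ^ 3 ≤ 1 := by
    nlinarith [mul_nonneg (sq_nonneg (1 - t)) (by linarith : 0 ≤ 1 + 2 * t)]
  constructor <;> nlinarith

/-- Keeping the factor `(q - p) ^ 2` charges the cutoff error only to edges whose ends carry
different cutoff values. -/
theorem cubicStep'_sq_le {p q l l₀ x : ℝ} (h₀ : 0 < l₀) (hl : l₀ ≤ l) (hx : x ∈ Icc 0 l) :
    cubicStep' p q l x ^ 2 ≤ (q - p) ^ 2 * (36 / l₀ ^ 2) := by
  have hl' : 0 < l := h₀.trans_le hl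
  have h0 : 0 ≤ x / l := div_nonneg hx.1 hl'.le
  have h1 : x / l ≤ 1 := (div_le_one hl').2 hx.2
  unfold cubicStep'
  set t := x / l
  rw [div_pow, mul_pow, mul_div_assoc]
  refine mul_le_mul_of_nonneg_left ?_ (sq_nonneg _)
  gcongr
  have : 0 ≤ 6 * t - 6 * t ^ 2 := by nlinarith
  have : 6 * t - 6 * t ^ 2 ≤ 6 := by nlinarith
  nlinarith

theorem cubicStep''_sq_le {p q l l₀ x : ℝ} (h₀ : 0 < l₀) (hl : l₀ ≤ l) (hx : x ∈ Icc 0 l) :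
    cubicStep'' p q l x ^ 2 ≤ (q - p) ^ 2 * (36 / l₀ ^ 4) := by
  have hl' : 0 < l := h₀.trans_le hl
  have h0 : 0 ≤ x / l := div_nonneg hx.1 hl'.le
  have h1 : x / l ≤ 1 := (div_le_one hl').2 hx.2
  unfold cubicStep''
  set t := x / l
  rw [div_pow, mul_pow, mul_div_assoc, ← pow_mul]
  refine mul_le_mul_of_nonneg_left ?_ (sq_nonneg _)
  norm_num only
  gcongr
  nlinarith

/-! ### Assembling elements of `L²(Γ)` from edges -/

theorem norm_sq_Lp {μ : Measure ℝ} (F : Lp ℂ 2 μ) : ‖F‖ ^ 2 = ∫ x, ‖F x‖ ^ 2 ∂μ := by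
  have h := L2.inner_def (𝕜 := ℂ) F F
  rw [inner_self_eq_norm_sq_to_K] at h
  simp only [inner_self_eq_norm_sq_to_K] at h
  simp only [← RCLike.ofReal_pow] at h
  rw [integral_ofReal] at h
  exact RCLike.ofReal_injective h

variable {V E : Type*} (Γ : MetricGraph V E)

theorem exists_L2_of_summable {g : E → ℝ → ℂ} (hg : ∀ e, MemLp (g e) 2 (Γ.edgeMeasure e))
    (hs : Summable fun e => ∫ x in Icc 0 (Γ.len e), ‖g e x‖ ^ 2) :
    ∃ u : Γ.L2, (∀ e, u e =ᵐ[Γ.edgeMeasure e] g e) ∧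
      HasSum (fun e => ∫ x in Icc 0 (Γ.len e), ‖g e x‖ ^ 2) (‖u‖ ^ 2) := by
  have hn : ∀ e, ‖(hg e).toLp (g e)‖ ^ 2 = ∫ x in Icc 0 (Γ.len e), ‖g e x‖ ^ 2 := fun e => by
    rw [norm_sq_Lp]
    exact integral_congr_ae ((hg e).coeFn_toLp.mono fun x hx => by simp only [hx])
  have hmem : Memℓp (fun e => (hg e).toLp (g e)) 2 := by
    refine memℓp_gen ?_
    simpa only [ENNReal.toReal_ofNat, Real.rpow_ofNat, hn] using hs
  refine ⟨⟨_, hmem⟩, fun e => (hg e).coeFn_toLp, ?_⟩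
  have := lp.hasSum_norm (p := 2) (by norm_num) (⟨_, hmem⟩ : Γ.L2)
  simpa only [ENNReal.toReal_ofNat, Real.rpow_ofNat, hn] using this

variable {Γ}

/-! ### Distances and mass within a given radius -/

theorem HasPath.nonneg {u v : V} {a : ℝ} (h : Γ.HasPath u v a) : 0 ≤ a := by
  induction h with
  | nil => exact le_rfl
  | cons e b a _ ih => exact add_nonneg ih (Γ.len_pos e).le

/-- Append `e` to a path. Connectedness keeps the infimum from being that of the empty set, which is
0 by default. -/
theorem vertexDist_step (hconn : Γ.Connected) (o : V) (e : E) (b : Bool) :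
    Γ.vertexDist o (Γ.vert (e, !b)) ≤ Γ.vertexDist o (Γ.vert (e, b)) + Γ.len e := by
  rw [← sub_le_iff_le_add]
  refine le_csInf (hconn o _) fun a ha => ?_
  rw [sub_le_iff_le_add]
  exact csInf_le ⟨0, fun _ h => h.nonneg⟩ (ha.cons e b a)

theorem vertexDist_term_le (hconn : Γ.Connected) (o : V) (e : E) :
    Γ.vertexDist o (Γ.term e) ≤ Γ.vertexDist o (Γ.init e) + Γ.len e := by
  simpa [vert] using vertexDist_step hconn o e false

theorem vertexDist_init_le (hconn : Γ.Connected) (o : V) (e : E) :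
    Γ.vertexDist o (Γ.init e) ≤ Γ.vertexDist o (Γ.term e) + Γ.len e := by
  simpa [vert] using vertexDist_step hconn o e true

variable (Γ)

/-- The edges both of whose end vertices lie within distance `r` of `o`. -/
def innerEdges (o : V) (r : ℝ) : Set E :=
  {e | Γ.vertexDist o (Γ.init e) ≤ r ∧ Γ.vertexDist o (Γ.term e) ≤ r}

/-- The integral `∫ |φ|²` over the edge `e`. -/
noncomputable def edgeMass (φ : E → ℝ → ℂ) (e : E) : ℝ := ∫ x in Icc 0 (Γ.len e), ‖φ e x‖ ^ 2

/-- The integral `∫ |φ|²` over the edges both of whose end vertices lie within distance `r`. -/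
noncomputable def innerMass (o : V) (r : ℝ) (φ : E → ℝ → ℂ) : ℝ :=
  ∑' e, (Γ.innerEdges o r).indicator (Γ.edgeMass φ) e

theorem edgeMass_nonneg (φ : E → ℝ → ℂ) (e : E) : 0 ≤ Γ.edgeMass φ e :=
  integral_nonneg fun _ => by positivity

/-- An edge of length at most `L` with both ends within `r` lies wholly in the ball of radius `r +
L`. Summability has to be recorded, since a divergent real `tsum` is 0. -/
theorem summable_innerMass {o : V} {r L B : ℝ} {φ : E → ℝ → ℂ} (hB : 0 ≤ B)
    (hφ : ∀ e, ContinuousOn (φ e) (Icc 0 (Γ.len e))) (hL : ∀ e, Γ.len e ≤ L)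
    (h : Γ.ballMass o (r + L) φ ≤ ENNReal.ofReal B) :
    Summable ((Γ.innerEdges o r).indicator (Γ.edgeMass φ)) ∧ Γ.innerMass o r φ ≤ B := by
  have hnn : ∀ e, 0 ≤ (Γ.innerEdges o r).indicator (Γ.edgeMass φ) e := fun e =>
    indicator_nonneg (fun e _ => Γ.edgeMass_nonneg φ e) e
  have hle : ∑' e, ENNReal.ofReal ((Γ.innerEdges o r).indicator (Γ.edgeMass φ) e) ≤
      ENNReal.ofReal B := by
    refine le_trans (ENNReal.tsum_le_tsum fun e => ?_) h
    by_cases he : e ∈ Γ.innerEdges o r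
    · have hball : Γ.ballOn o (r + L) e = Icc 0 (Γ.len e) := by
        refine Subset.antisymm (fun x hx => hx.1) fun x hx => ⟨hx, ?_⟩
        exact (min_le_left _ _).trans (add_le_add he.1 (hx.2.trans (hL e)))
      have hi : IntegrableOn (fun x => ‖φ e x‖ ^ 2) (Icc 0 (Γ.len e)) :=
        ((hφ e).norm.pow 2).integrableOn_compact isCompact_Icc
      rw [indicator_of_mem he, hball, edgeMass, ofReal_integral_eq_lintegral_ofReal hi
        (Filter.Eventually.of_forall fun x => sq_nonneg _)]
      refine lintegral_mono fun x => ?_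
      rw [ENNReal.ofReal_pow (norm_nonneg _), ofReal_norm]
    · rw [indicator_of_notMem he]
      simp
  have hs : Summable ((Γ.innerEdges o r).indicator (Γ.edgeMass φ)) := by
    have := ENNReal.summable_toReal (ne_top_of_le_ne_top ENNReal.ofReal_ne_top hle)
    simpa [ENNReal.toReal_ofReal (hnn _)] using this
  refine ⟨hs, ?_⟩
  rw [← ENNReal.ofReal_tsum_of_nonneg hnn hs] at hle
  exact (ENNReal.ofReal_le_ofReal_iff hB).1 hle

variable {Γ}

/-! ### Cutting off the generalized eigenfunction -/

/-- Values and derivatives at `v` are scaled by the same number `c v`, and `M v` is a linear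
subspace. -/
theorem VertexConditions.Satisfies.cutoff {M : Γ.VertexConditions} {φ φ' ψ ψ' : E → ℝ → ℂ}
    (h : M.Satisfies φ φ') (c : V → ℂ)
    (h0 : ∀ e, ψ e 0 = c (Γ.init e) * φ e 0)
    (h1 : ∀ e, ψ e (Γ.len e) = c (Γ.term e) * φ e (Γ.len e))
    (h0' : ∀ e, ψ' e 0 = c (Γ.init e) * φ' e 0)
    (h1' : ∀ e, ψ' e (Γ.len e) = c (Γ.term e) * φ' e (Γ.len e)) : M.Satisfies ψ ψ' := by
  intro v
  convert (M v).smul_mem (c v) (h v) using 1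
  ext i
  · obtain ⟨⟨e, b⟩, rfl⟩ := i
    change Γ.endValue ψ (e, b) = c _ * Γ.endValue φ (e, b)
    cases b <;> simp [endValue, vert, h0, h1]
  · obtain ⟨⟨e, b⟩, rfl⟩ := i
    change Γ.endDeriv ψ' (e, b) = c _ * Γ.endDeriv φ' (e, b)
    cases b <;> simp [endDeriv, vert, h0', h1']

/-- Cutting off a generalized eigenfunction `φ` between the distances `r` and `r + L` gives an
element `u` of the domain of the Hamiltonian for which `(H - lam) u` is controlled by the mass of
`φ` in the cutoff region. -/
theorem exists_quasimode (hconn : Γ.Connected) {l₀ L : ℝ} (h₀ : 0 < l₀)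
    (hlen : ∀ e, Γ.len e ∈ Icc l₀ L) (o : V) {M : Γ.VertexConditions} {lam : ℝ}
    {φ φ' : E → ℝ → ℂ}
    (hφ : ∀ e, IsH2 (Γ.len e) (φ e) (φ' e) (fun x => (-lam) • φ e x))
    (hM : M.Satisfies φ φ') {r : ℝ}
    (hs : Summable ((Γ.innerEdges o (r + L)).indicator (Γ.edgeMass φ)))
    (hs₀ : Summable ((Γ.innerEdges o r).indicator (Γ.edgeMass φ))) :
    ∃ u w : Γ.L2, (u, w + (lam : ℂ) • u) ∈ Γ.hamiltonianGraph M ∧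
      Γ.innerMass o r φ ≤ ‖u‖ ^ 2 ∧
      ‖w‖ ^ 2 ≤ (10 * (36 / l₀ ^ 4) + 8 * |lam| * (36 / l₀ ^ 2)) *
        (Γ.innerMass o (r + L) φ - Γ.innerMass o r φ) := by
  classical
  set C := 10 * (36 / l₀ ^ 4) + 8 * |lam| * (36 / l₀ ^ 2)
  have hC : 0 ≤ C := by positivity
  let c : V → ℝ := fun v => if Γ.vertexDist o v ≤ r then 1 else 0
  have hc : ∀ v, |c v| ≤ 1 := fun v => by by_cases h : Γ.vertexDist o v ≤ r <;> simp [c, h]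
  let θ : E → ℝ → ℝ := fun e => cubicStep (c (Γ.init e)) (c (Γ.term e)) (Γ.len e)
  let θ' : E → ℝ → ℝ := fun e => cubicStep' (c (Γ.init e)) (c (Γ.term e)) (Γ.len e)
  let θ'' : E → ℝ → ℝ := fun e => cubicStep'' (c (Γ.init e)) (c (Γ.term e)) (Γ.len e)
  have hθd : ∀ e, deriv (θ e) = θ' e := fun e => funext fun x => (hasDerivAt_cubicStep ..).deriv
  have hθd' : ∀ e, deriv (θ' e) = θ'' e := fun e =>
    funext fun x => (hasDerivAt_cubicStep' ..).deriv
  have hθ : ∀ e, ContDiff ℝ ∞ (θ e) := fun e => contDiff_cubicStep ..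
  have hθ' : ∀ e, ContDiff ℝ ∞ (θ' e) := fun e => hθd e ▸ (contDiff_infty_iff_deriv.1 (hθ e)).2
  have hθ'' : ∀ e, ContDiff ℝ ∞ (θ'' e) := fun e =>
    hθd' e ▸ (contDiff_infty_iff_deriv.1 (hθ' e)).2
  have hψ := fun e => (hφ e).mul_contDiff (hθ e) (hθd e) (hθd' e)
  set A : E → ℝ := Γ.edgeMass φ
  have hA : ∀ e, 0 ≤ A e := Γ.edgeMass_nonneg φ
  have hAi : ∀ e, IntegrableOn (fun x => ‖φ e x‖ ^ 2) (Icc 0 (Γ.len e)) := fun e =>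
    ((hφ e).cont.norm.pow 2).integrableOn_compact isCompact_Icc
  have hmem : ∀ {l : ℝ} {g : ℝ → ℂ}, ContinuousOn g (Icc 0 l) →
      MemLp g 2 (volume.restrict (Icc 0 l)) := fun hg => by
    obtain ⟨B, hB⟩ := isCompact_Icc.exists_bound_of_continuousOn hg
    exact MemLp.of_bound (hg.aestronglyMeasurable measurableSet_Icc) B
      ((ae_restrict_iff' measurableSet_Icc).2 (Filter.Eventually.of_forall hB))
  have hind : ∀ e, (c (Γ.init e) = 0 ∧ c (Γ.term e) = 0) ∨ e ∈ Γ.innerEdges o (r + L) := by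
    intro e
    have hl := Γ.len_pos e
    have hL := (hlen e).2
    have t1 := vertexDist_term_le hconn o e
    have t2 := vertexDist_init_le hconn o e
    by_cases p : Γ.vertexDist o (Γ.init e) ≤ r
    · exact Or.inr ⟨by linarith, by linarith⟩
    · by_cases q : Γ.vertexDist o (Γ.term e) ≤ r
      · exact Or.inr ⟨by linarith, by linarith⟩
      · exact Or.inl ⟨by simp [c, p], by simp [c, q]⟩
  have hinner : ∀ e, e ∈ Γ.innerEdges o r → c (Γ.init e) = 1 ∧ c (Γ.term e) = 1 :=
    fun e he => ⟨by simp [c, he.1], by simp [c, he.2]⟩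
  -- The left side is nonzero only on transition edges, which belong to the larger inner set but not
  -- to the smaller one.
  have hsq : ∀ e, (c (Γ.term e) - c (Γ.init e)) ^ 2 * A e ≤
      (Γ.innerEdges o (r + L)).indicator A e - (Γ.innerEdges o r).indicator A e := by
    intro e
    by_cases h1 : e ∈ Γ.innerEdges o r
    · have h2 : e ∈ Γ.innerEdges o (r + L) := by
        have := (Γ.len_pos e).le.trans (hlen e).2
        exact ⟨by linarith [h1.1], by linarith [h1.2]⟩
      simp [h1, h2, hinner e h1]
    · rcases hind e with h2 | h2
      · simpa [h1, h2] using indicator_nonneg (fun e _ => hA e) e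
      · rw [indicator_of_notMem h1, indicator_of_mem h2, sub_zero]
        refine mul_le_of_le_one_left (hA e) ?_
        by_cases p : Γ.vertexDist o (Γ.init e) ≤ r <;>
          by_cases q : Γ.vertexDist o (Γ.term e) ≤ r <;> simp [c, p, q]
  have hu_le : ∀ e, ∫ x in Icc 0 (Γ.len e), ‖θ e x • φ e x‖ ^ 2 ≤
      (Γ.innerEdges o (r + L)).indicator A e := by
    intro e
    rcases hind e with h2 | h2
    · simpa [θ, h2, cubicStep_self] using indicator_nonneg (fun e _ => hA e) e
    · rw [indicator_of_mem h2]
      refine setIntegral_mono_on ((hψ e).cont.norm.pow 2 |>.integrableOn_compact isCompact_Icc)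
        (hAi e) measurableSet_Icc fun x hx => ?_
      rw [norm_smul]
      have := abs_cubicStep_le (hc (Γ.init e)) (hc (Γ.term e)) (Γ.len_pos e) hx
      gcongr
      exact mul_le_of_le_one_left (norm_nonneg _) this
  obtain ⟨u, hu, hun⟩ := Γ.exists_L2_of_summable (g := fun e x => θ e x • φ e x)
    (fun e => hmem (hψ e).cont)
    (Summable.of_nonneg_of_le (fun e => integral_nonneg fun x => sq_nonneg _) hu_le hs)
  have hgc : ∀ e, ContinuousOn (fun x => θ'' e x • φ e x + (2 * θ' e x) • φ' e x)
      (Icc 0 (Γ.len e)) := fun e =>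
    ((hθ'' e).continuous.continuousOn.smul (hφ e).cont).add
      ((continuous_const.mul (hθ' e).continuous).continuousOn.smul (hφ e).cont')
  have hw_le : ∀ e, ∫ x in Icc 0 (Γ.len e),
      ‖-(θ'' e x • φ e x + (2 * θ' e x) • φ' e x)‖ ^ 2 ≤
      C * ((Γ.innerEdges o (r + L)).indicator A e - (Γ.innerEdges o r).indicator A e) := by
    intro e
    have hl := Γ.len_pos e
    simp only [norm_neg]
    refine (integral_commutator_sq_le (lam := lam) hl (hφ e).cont (hφ e).cont'
      (fun x hx => (hφ e).weak.hasDerivAt hl (hφ e).cont (hφ e).cont' hx)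
      (fun x hx => (hφ e).weak'.hasDerivAt hl (hφ e).cont'
        ((hφ e).cont.const_smul (-lam)) hx)
      (fun x => hasDerivAt_cubicStep' ..) (hθ'' e).continuous
      (cubicStep'_zero ..) (cubicStep'_right _ _ hl)
      (fun x hx => cubicStep'_sq_le h₀ (hlen e).1 hx)
      (fun x hx => cubicStep''_sq_le h₀ (hlen e).1 hx)).trans ?_
    refine le_trans (le_of_eq ?_) (mul_le_mul_of_nonneg_left (hsq e) hC)
    simp only [A, edgeMass, C]
    ring
  have hsd : Summable fun e => C * ((Γ.innerEdges o (r + L)).indicator A e -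
      (Γ.innerEdges o r).indicator A e) := (hs.sub hs₀).mul_left C
  -- By `-φ'' = lam φ`, the second derivative of `θφ` leaves exactly this commutator as `(H - lam)
  -- u`.
  obtain ⟨w, hw, hwn⟩ := Γ.exists_L2_of_summable
    (g := fun e x => -(θ'' e x • φ e x + (2 * θ' e x) • φ' e x))
    (fun e => hmem (hgc e).neg)
    (Summable.of_nonneg_of_le (fun e => integral_nonneg fun x => sq_nonneg _) hw_le hsd)
  refine ⟨u, w, ⟨_, _, _, hψ, ?_, hu, fun e => ?_⟩, ?_, ?_⟩
  · refine hM.cutoff (fun v => (c v : ℂ)) ?_ ?_ ?_ ?_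
    · intro e; simp [θ, cubicStep_zero]
    · intro e; simp [θ, cubicStep_right _ _ (Γ.len_pos e)]
    · intro e; simp [θ, θ', cubicStep_zero, cubicStep'_zero]
    · intro e
      simp [θ, θ', cubicStep_right _ _ (Γ.len_pos e), cubicStep'_right _ _ (Γ.len_pos e)]
  · have e1 : (w + (lam : ℂ) • u) e = w e + (lam : ℂ) • u e := rfl
    rw [e1]
    filter_upwards [hu e, hw e, Lp.coeFn_add (w e) ((lam : ℂ) • u e),
      Lp.coeFn_smul (lam : ℂ) (u e)] with x h1 h2 h3 h4
    rw [h3, Pi.add_apply, h4, Pi.smul_apply, h1, h2, Complex.coe_smul, Pi.neg_apply]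
    module
  · refine hasSum_le (fun e => ?_) hs₀.hasSum hun
    by_cases h1 : e ∈ Γ.innerEdges o r
    · simp only [indicator_of_mem h1]
      simp [θ, hinner e h1, cubicStep_self, A, edgeMass]
    · rw [indicator_of_notMem h1]
      exact integral_nonneg fun x => sq_nonneg _
  · exact hasSum_le hw_le hwn ((hs.hasSum.sub hs₀.hasSum).mul_left C)

/-! ### Growth contradiction and conclusion -/

theorem edgeMass_pos {φ : E → ℝ → ℂ} {e : E} (hφ : ContinuousOn (φ e) (Icc 0 (Γ.len e)))
    (hne : ∃ x ∈ Icc 0 (Γ.len e), φ e x ≠ 0) : 0 < Γ.edgeMass φ e := by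
  have hl := Γ.len_pos e
  obtain ⟨x, hx, hxne⟩ := hne
  have h := intervalIntegral.integral_pos hl (hφ.norm.pow 2)
    (fun x _ => sq_nonneg _) ⟨x, hx, pow_pos (norm_pos_iff.2 hxne) 2⟩
  rw [intervalIntegral.integral_of_le hl.le, ← integral_Icc_eq_integral_Ioc] at h
  exact h

/-- A sequence that grows at least geometrically is not of subexponential growth. -/
theorem false_of_geometric_of_subexponential {K : ℕ → ℝ} {D : ℝ} (hD : 0 < D)
    (hK : ∀ n, K n ≤ D * (K (n + 1) - K n)) {n₀ : ℕ} (hpos : 0 < K n₀)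
    (hgrowth : ∀ ε > 0, ∃ B : ℝ, ∀ n : ℕ, K n ≤ B * Real.exp (ε * n)) : False := by
  have hq : 1 < 1 + 1 / D := by linarith [one_div_pos.2 hD]
  set q := 1 + 1 / D with hqdef
  have hstep : ∀ n, q * K n ≤ K (n + 1) := fun n => by
    have h : K n / D ≤ K (n + 1) - K n := (div_le_iff₀' hD).2 (hK n)
    have : q * K n = K n + K n / D := by rw [hqdef]; ring
    linarith
  have hpow : ∀ m, q ^ m * K n₀ ≤ K (n₀ + m) := fun m => by
    induction m with
    | zero => simp
    | succ m ih =>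
      calc q ^ (m + 1) * K n₀ = q * (q ^ m * K n₀) := by ring
        _ ≤ q * K (n₀ + m) := mul_le_mul_of_nonneg_left ih (by linarith)
        _ ≤ _ := hstep _
  -- With half the rate, `q = exp ε * exp ε`: one factor matches the assumed growth, the other
  -- outgrows the constant `B`.
  set ε := Real.log q / 2
  have hε : 0 < ε := half_pos (Real.log_pos hq)
  have hqs : q = Real.exp ε * Real.exp ε := by
    rw [← Real.exp_add, add_halves, Real.exp_log (by linarith)]
  obtain ⟨B, hB⟩ := hgrowth ε hε
  obtain ⟨m, hm⟩ := pow_unbounded_of_one_lt (B * Real.exp (ε * n₀) / K n₀)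
    (Real.one_lt_exp_iff.2 hε)
  rw [div_lt_iff₀ hpos] at hm
  have h := (hpow m).trans (hB (n₀ + m))
  have he : Real.exp (ε * ((n₀ + m : ℕ) : ℝ)) = Real.exp (ε * n₀) * Real.exp ε ^ m := by
    rw [← Real.exp_nat_mul, ← Real.exp_add]
    push_cast
    ring_nf
  rw [he, hqs, mul_pow] at h
  have hs : 0 < Real.exp ε ^ m := by positivity
  have := mul_lt_mul_of_pos_right hm hs
  linarith

/-- Here `w = (T - z) u`, so `u = R w` for the resolvent `R`, and `‖R‖` serves as `c`. -/
theorem exists_norm_le_mul_of_notMem_spectrum {X : Type*} [NormedAddCommGroup X]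
    [NormedSpace ℂ X] {T : X →ₗ.[ℂ] X} {z : ℂ} (hz : z ∉ unboundedSpectrum T) :
    ∃ c : ℝ, ∀ u w : X, (u, w + z • u) ∈ T.graph → ‖u‖ ≤ c * ‖w‖ := by
  obtain ⟨R, -, hR⟩ := not_not.1 hz
  refine ⟨‖R‖, fun u w h => ?_⟩
  obtain ⟨y, hy, hTy⟩ := (LinearPMap.mem_graph_iff T).1 h
  have h1 := hR y
  simp only at hy hTy
  rw [hTy, hy, add_sub_cancel_right] at h1
  exact h1 ▸ R.le_opNorm w

end MetricGraph

theorem theorem3p1 {V E : Type*} [Countable V] [Infinite V] (Γ : MetricGraph V E)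
    (hconn : Γ.Connected) (hA : Γ.ConditionA) (o : V)
    (M : Γ.VertexConditions) (hM : M.SelfAdjoint) (lam : ℝ)
    (φ φ' φ'' : E → ℝ → ℂ)
    (hH2 : ∀ e, MetricGraph.IsH2 (Γ.len e) (φ e) (φ' e) (φ'' e))
    (hvert : M.Satisfies φ φ')
    (heq : ∀ e, ∀ᵐ x ∂(Γ.edgeMeasure e), -φ'' e x = (lam : ℂ) * φ e x)
    (hne : ∃ e, ∃ x ∈ Set.Icc 0 (Γ.len e), φ e x ≠ 0)
    (hgrowth : ∀ ε > 0, ∃ C : ℝ, ∀ r ≥ 0,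
      Γ.ballMass o r φ ≤ ENNReal.ofReal (C * Real.exp (ε * r))) :
    (lam : ℂ) ∈ unboundedSpectrum (Γ.hamiltonian M) := by
  obtain ⟨l₀, L, h₀, hlen⟩ := hA
  obtain ⟨e₀, he₀⟩ := hne
  have hL : 0 < L := h₀.trans_le ((hlen e₀).1.trans (hlen e₀).2)
  have hφ : ∀ e, MetricGraph.IsH2 (Γ.len e) (φ e) (φ' e) (fun x => (-lam) • φ e x) := fun e =>
    (hH2 e).congr_ae ((heq e).mono fun x hx => by
      beta_reduce
      rw [neg_smul, ← Complex.coe_smul, smul_eq_mul, ← hx, neg_neg])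
  have hmass : ∀ ε > 0, ∃ B : ℝ, ∀ r ≥ 0,
      Summable ((Γ.innerEdges o r).indicator (Γ.edgeMass φ)) ∧
        Γ.innerMass o r φ ≤ B * Real.exp (ε * r) := fun ε hε => by
    obtain ⟨C, hC⟩ := hgrowth ε hε
    -- Enlarging the radius from `r` to `r + L` costs the factor `exp (ε * L)`; `|C|` makes the
    -- bound nonnegative.
    refine ⟨|C| * Real.exp (ε * L), fun r hr => ?_⟩
    have h := Γ.summable_innerMass (o := o) (r := r) (L := L)
      (B := |C| * Real.exp (ε * (r + L))) (by positivity) (fun e => (hφ e).cont)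
      (fun e => (hlen e).2) ((hC (r + L) (by linarith)).trans (ENNReal.ofReal_le_ofReal
        (mul_le_mul_of_nonneg_right (le_abs_self C) (Real.exp_pos _).le)))
    rwa [mul_add, Real.exp_add, mul_comm (Real.exp (ε * r)), ← mul_assoc] at h
  have hsum : ∀ r ≥ 0, Summable ((Γ.innerEdges o r).indicator (Γ.edgeMass φ)) := fun r hr =>
    ((hmass 1 one_pos).choose_spec r hr).1
  by_contra hlam
  obtain ⟨c, hc⟩ := MetricGraph.exists_norm_le_mul_of_notMem_spectrum hlam
  set C := 10 * (36 / l₀ ^ 4) + 8 * |lam| * (36 / l₀ ^ 2)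
  have hCpos : 0 < C := by positivity
  -- From radius `n₀ * L` on, the inner mass contains the edge `e₀` where φ is not zero.
  obtain ⟨n₀, hn₀⟩ := exists_nat_ge
    (max (Γ.vertexDist o (Γ.init e₀)) (Γ.vertexDist o (Γ.term e₀)) / L)
  rw [div_le_iff₀ hL] at hn₀
  -- The summand 1 ensures `D > 0` even if `c = 0`; it is harmless because the increments of the
  -- mass are nonnegative.
  refine MetricGraph.false_of_geometric_of_subexponential
    (K := fun n : ℕ => Γ.innerMass o (n * L) φ) (D := c ^ 2 * C + 1) (n₀ := n₀)
    (by positivity) (fun n => ?_) ?_ fun ε hε => ?_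
  · have hr : (0 : ℝ) ≤ n * L := by positivity
    obtain ⟨u, w, hgraph, hu, hw⟩ := MetricGraph.exists_quasimode hconn h₀ hlen o hφ hvert
      (hsum (n * L + L) (by positivity)) (hsum (n * L) hr)
    rw [← Γ.hamiltonian_graph M] at hgraph
    have huw := hc u w hgraph
    have hsq : ‖u‖ ^ 2 ≤ c ^ 2 * ‖w‖ ^ 2 := by
      rw [← mul_pow]
      exact pow_le_pow_left₀ (norm_nonneg u) huw 2
    have he : ((n + 1 : ℕ) : ℝ) * L = n * L + L := by push_cast; ring
    simp only [he]
    set Δ := Γ.innerMass o (n * L + L) φ - Γ.innerMass o (n * L) φ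
    have hΔ : 0 ≤ Δ := nonneg_of_mul_nonneg_right ((sq_nonneg ‖w‖).trans hw) hCpos
    have := mul_le_mul_of_nonneg_left hw (sq_nonneg c)
    linarith
  · have hmem : e₀ ∈ Γ.innerEdges o (n₀ * L) :=
      ⟨(le_max_left _ _).trans hn₀, (le_max_right _ _).trans hn₀⟩
    refine (hsum (n₀ * L) (by positivity)).tsum_pos
      (indicator_nonneg fun e _ => Γ.edgeMass_nonneg φ e) e₀ ?_
    rw [indicator_of_mem hmem]
    exact MetricGraph.edgeMass_pos (hφ e₀).cont he₀
  · obtain ⟨B, hB⟩ := hmass (ε / L) (by positivity)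
    refine ⟨B, fun n => ?_⟩
    have h := (hB (n * L) (by positivity)).2
    rwa [show ε / L * (n * L) = ε * n by field_simp] at h
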